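/- Let $\kappa\in\mathbb R$. For points $p,q,r$ of a metric space, the model angle $\tilde\angle^{\kappa}(p;q,r)\in[0,\pi]$ is defined when $|pq|>0$, $|pr|>0$ and, if $\kappa>0$, also $|pq|+|qr|+|rp|<2\pi/\sqrt\kappa$. In that case it is the angle at $\tilde p$ of a triangle $\tilde p\tilde q\tilde r$ with $|\tilde p\tilde q|=|pq|$, $|\tilde q\tilde r|=|qr|$, $|\tilde r\tilde p|=|rp|$ in the complete simply connected surface of constant curvature $\kappa$; equivalently, it is given by the cosine law of curvature $\kappa$. A quadruple $p,x^1,x^2,x^3$ satisfies the $\mathrm{Alex}(\kappa)$ comparison if $$\tilde\angle^{\kappa}(p;x^1,x^2)+\tilde\angle^{\kappa}(p;x^2,x^3)+\tilde\angle^{\kappa}(p;x^3,x^1)\le 2\pi$$ or if at least one of these three model angles is not defined. A metric space is $\mathrm{Alex}(\kappa)$ if all its quadruples satisfy this comparison, and locally $\mathrm{Alex}(\kappa)$ if each of its points has a neighborhood $\Omega$ such that all quadruples in $\Omega$ satisfy it. A metric space (with finite distances) is a length space if the distance between any two points is the infimum of the lengths of the paths joining them. **Globalization theorem.** Every complete length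 space that is locally $\mathrm{Alex}(\kappa)$ is $\mathrm{Alex}(\kappa)$. -/

import Mathlib

/-- The generalized cosine `cs κ`: the solution of `x'' + κ x = 0`, `x 0 = 1`, `x' 0 = 0`. -/
noncomputable def cs (κ t : ℝ) : ℝ :=
  if 0 ≤ κ then Real.cos (√κ * t) else Real.cosh (√(-κ) * t)

/-- The generalized sine `sn κ`: the solution of `y'' + κ y = 0`, `y 0 = 0`, `y' 0 = 1`. -/
noncomputable def sn (κ t : ℝ) : ℝ :=
  if 0 < κ then Real.sin (√κ * t) / √κ
  else if κ = 0 then t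
  else Real.sinh (√(-κ) * t) / √(-κ)

/-- The model angle opposite to the side `a` in a triangle with sides `a, b, c` in the complete
simply connected surface of constant curvature `κ`, computed by the cosine law. -/
noncomputable def modelAngleOfSides (κ a b c : ℝ) : ℝ :=
  if κ = 0 then Real.arccos ((b ^ 2 + c ^ 2 - a ^ 2) / (2 * b * c))
  else Real.arccos ((cs κ a - cs κ b * cs κ c) / (κ * sn κ b * sn κ c))

section Comparison

variable {X : Type*} [MetricSpace X]

/-- The model angle at `p` of the triple `p, q, r`. It is meaningful under `ModelAngleDefined`. -/
noncomputable def modelAngle (κ : ℝ) (p q r : X) : ℝ :=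
  modelAngleOfSides κ (dist q r) (dist p q) (dist p r)

/-- The model angle at `p` of the triple `p, q, r` is defined: the two sides at `p` are
nondegenerate, and for `κ > 0` the perimeter is less than `2π / √κ`. -/
def ModelAngleDefined (κ : ℝ) (p q r : X) : Prop :=
  0 < dist p q ∧ 0 < dist p r ∧
    (0 < κ → dist p q + dist q r + dist r p < 2 * (Real.pi / √κ))

/-- The four-point comparison for the quadruple `p, x₁, x₂, x₃`: the three model angles at `p` sum
to at most `2π`, or at least one of them is not defined. -/
def FourPointComparison (κ : ℝ) (p x₁ x₂ x₃ : X) : Prop :=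
  modelAngle κ p x₁ x₂ + modelAngle κ p x₂ x₃ + modelAngle κ p x₃ x₁ ≤ 2 * Real.pi ∨
    ¬ ModelAngleDefined κ p x₁ x₂ ∨ ¬ ModelAngleDefined κ p x₂ x₃ ∨
    ¬ ModelAngleDefined κ p x₃ x₁

variable (X)

/-- `X` is `Alex(κ)`: every quadruple satisfies the four-point comparison. -/
def IsAlex (κ : ℝ) : Prop :=
  ∀ p x₁ x₂ x₃ : X, FourPointComparison κ p x₁ x₂ x₃

/-- `X` is locally `Alex(κ)`: every point has a neighborhood all of whose quadruples satisfy the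
four-point comparison. -/
def IsLocallyAlex (κ : ℝ) : Prop :=
  ∀ q : X, ∃ Ω ∈ nhds q, ∀ p ∈ Ω, ∀ x₁ ∈ Ω, ∀ x₂ ∈ Ω, ∀ x₃ ∈ Ω,
    FourPointComparison κ p x₁ x₂ x₃

/-- `X` is a length space: the distance between any two points is the infimum of the lengths of
the paths joining them. -/
def IsLengthSpace : Prop :=
  ∀ x y : X, ⨅ γ : Path x y, eVariationOn γ Set.univ = edist x y

end Comparison

/-! Hinge comparison is the form of the curvature bound that propagates. At small scale,
Alexandrov's lemma turns the four-point comparison into monotonicity of model angles along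
geodesics. Hence angles exist and dominate model angles, three angles at a point sum to at most 2π,
and the two angles at an inner point of a geodesic sum to at most π.

The key lemma `HingeComparison.enlarge` passes from hinges of size ℓ to size 3ℓ/2. Slide the vertex
along the longer side: by `hingeMd_le_hingeMd` the predicted third side does not grow. Either the
hinge becomes definitely shorter, and finitely many moves bring it below ℓ, or the triangle
inequality is almost an equality and the prediction is almost the sum of the sides, which no third
side can exceed. Iterating, and then sliding once more under a perimeter bound, gives model angle ≤
angle in large triangles, whence the four-point comparison.

Two obstacles remain. Minimizing geodesics may not exist, so the argument runs in an ultrapower,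
which is geodesic and inherits the local comparison. The scale of the local comparison need not be
uniform, so a failure is traced to smaller and smaller balls; completeness provides a limit point,
where the local hypothesis is violated. -/

open Real Set Filter Topology

/-! ### Trigonometry of the model surfaces, uniform in κ. -/

/-- The modified distance: the solution of `f'' + κ f = 1`, `f 0 = 0`, `f' 0 = 0`. -/
noncomputable def md (κ t : ℝ) : ℝ :=
  if κ = 0 then t ^ 2 / 2 else (1 - cs κ t) / κ

theorem cs_eq_one_sub (κ t : ℝ) : cs κ t = 1 - κ * md κ t := by
  unfold md
  split_ifs with h
  · subst h; simp [cs]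
  · field_simp; ring

theorem sn_zero (κ : ℝ) : sn κ 0 = 0 := by simp [sn]

theorem md_zero (κ : ℝ) : md κ 0 = 0 := by simp [md, cs]

theorem sn_neg (κ t : ℝ) : sn κ (-t) = -sn κ t := by
  unfold sn; split_ifs <;> simp [neg_div]

theorem md_neg (κ t : ℝ) : md κ (-t) = md κ t := by
  simp [md, cs]

theorem cs_neg (κ t : ℝ) : cs κ (-t) = cs κ t := by
  simp [cs]

theorem sn_add (κ s t : ℝ) : sn κ (s + t) = sn κ s * cs κ t + cs κ s * sn κ t := by
  rcases lt_trichotomy κ 0 with h | rfl | h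
  · simp only [sn, cs, not_lt.2 h.le, not_le.2 h, h.ne, if_false, mul_add, Real.sinh_add]
    ring
  · simp [sn, cs]
  · simp only [sn, cs, h, h.le, if_true, mul_add, Real.sin_add]
    ring

theorem md_add (κ s t : ℝ) : md κ (s + t) = md κ s + cs κ s * md κ t + sn κ s * sn κ t := by
  rcases lt_trichotomy κ 0 with h | rfl | h
  · have h1 : √(-κ) ^ 2 = -κ := Real.sq_sqrt (by linarith)
    have h2 : √(-κ) ≠ 0 := (Real.sqrt_pos.2 (by linarith)).ne'
    have h3 : κ = - √(-κ) ^ 2 := by linarith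
    simp only [md, sn, cs, not_lt.2 h.le, not_le.2 h, h.ne, if_false, mul_add, Real.cosh_add]
    generalize √(-κ) = k at *
    subst h3
    field_simp
    ring
  · simp [sn, cs, md]; ring
  · have h1 : √κ ^ 2 = κ := Real.sq_sqrt h.le
    have h2 : √κ ≠ 0 := (Real.sqrt_pos.2 h).ne'
    simp only [md, sn, cs, h, h.le, h.ne', if_true, if_false, mul_add, Real.cos_add]
    generalize √κ = k at *
    subst h1
    field_simp
    ring

theorem md_add_sub_md_sub (κ u v : ℝ) : md κ (u + v) - md κ (u - v) = 2 * (sn κ u * sn κ v) := by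
  rw [sub_eq_add_neg u v, md_add, md_add, md_neg, sn_neg]; ring

/-- The product form reduces inequalities between values of `md` to signs of `sn`. -/
theorem md_sub_md (κ s t : ℝ) :
    md κ s - md κ t = 2 * (sn κ ((s + t) / 2) * sn κ ((s - t) / 2)) := by
  rw [← md_add_sub_md_sub]; congr 2 <;> ring

theorem continuous_cs (κ : ℝ) : Continuous (cs κ) := by
  unfold cs
  split_ifs <;> fun_prop

theorem continuous_sn (κ : ℝ) : Continuous (sn κ) := by
  unfold sn
  split_ifs <;> fun_prop

theorem continuous_md (κ : ℝ) : Continuous (md κ) := by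
  unfold md
  have := continuous_cs κ
  split_ifs <;> fun_prop

theorem sn_pos {κ t : ℝ} (ht : 0 < t) (h : 0 < κ → t < π / √κ) : 0 < sn κ t := by
  unfold sn
  split_ifs with h1 h2
  · have hk := Real.sqrt_pos.2 h1
    refine div_pos (Real.sin_pos_of_pos_of_lt_pi (by positivity) ?_) hk
    have := (lt_div_iff₀ hk).1 (h h1)
    linarith
  · exact ht
  · have hk : 0 < √(-κ) := Real.sqrt_pos.2 (by
      rcases lt_trichotomy κ 0 with h | h | h
      · linarith
      · exact absurd h h2
      · exact absurd h h1)
    exact div_pos (Real.sinh_pos_iff.2 (by positivity)) hk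

theorem sn_nonneg {κ t : ℝ} (ht : 0 ≤ t) (h : 0 < κ → t ≤ π / √κ) : 0 ≤ sn κ t := by
  by_cases h1 : 0 < κ ∧ t = π / √κ
  · have hk := Real.sqrt_pos.2 h1.1
    rw [sn, if_pos h1.1, h1.2, mul_div_cancel₀ _ hk.ne']; simp
  · rcases ht.eq_or_lt with rfl | ht
    · rw [sn_zero]
    · exact (sn_pos ht fun hk => lt_of_le_of_ne (h hk) fun e => h1 ⟨hk, e⟩).le

theorem md_le_md {κ s t : ℝ} (hs : 0 ≤ s) (hst : s ≤ t) (h : 0 < κ → t ≤ π / √κ) :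
    md κ s ≤ md κ t := by
  have h1 : 0 ≤ sn κ ((t + s) / 2) :=
    sn_nonneg (by linarith) fun hk => (by linarith : (t + s) / 2 ≤ t).trans (h hk)
  have h2 : 0 ≤ sn κ ((t - s) / 2) :=
    sn_nonneg (by linarith) fun hk => (by linarith : (t - s) / 2 ≤ t).trans (h hk)
  have := md_sub_md κ t s
  nlinarith [mul_nonneg h1 h2]

/-- The cosine of the model angle opposite to the side `a`. -/
noncomputable def cosRatio (κ a b c : ℝ) : ℝ :=
  (md κ b + cs κ b * md κ c - md κ a) / (sn κ b * sn κ c)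

theorem modelAngleOfSides_eq_arccos (κ a b c : ℝ) :
    modelAngleOfSides κ a b c = Real.arccos (cosRatio κ a b c) := by
  unfold modelAngleOfSides cosRatio
  split_ifs with h
  · subst h
    simp only [md, cs, sn, if_true, lt_irrefl, if_false, le_refl, Real.sqrt_zero, zero_mul,
      Real.cos_zero]
    congr 1
    rw [← mul_div_mul_left _ (b * c) (two_ne_zero)]
    congr 1 <;> ring
  · simp only [md, h, if_false]
    congr 1
    rw [mul_assoc, ← div_div]
    congr 1
    field_simp
    ring

/-- The modified length of the side opposite to an angle with cosine `c` between sides `a, b`. -/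
noncomputable def hingeMd (κ a b c : ℝ) : ℝ :=
  md κ a + cs κ a * md κ b - sn κ a * sn κ b * c

theorem hingeMd_comm (κ a b c : ℝ) : hingeMd κ a b c = hingeMd κ b a c := by
  have h1 := cs_eq_one_sub κ a
  have h2 := cs_eq_one_sub κ b
  unfold hingeMd
  linear_combination md κ b * h1 - md κ a * h2

theorem cosRatio_comm (κ a b c : ℝ) : cosRatio κ a b c = cosRatio κ a c b := by
  have := hingeMd_comm κ b c 0
  simp only [hingeMd, mul_zero, sub_zero] at this
  rw [cosRatio, cosRatio, this, mul_comm (sn κ b)]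

/-- The defect from a straight hinge is proportional to `sn κ b` when `a` and the angle are fixed,
so defects of hinges with a common side can be compared. -/
theorem md_add_sub_hingeMd (κ a b c : ℝ) :
    md κ (a + b) - hingeMd κ a b c = sn κ a * sn κ b * (1 + c) := by
  rw [md_add, hingeMd]; ring

theorem le_cosRatio_iff {κ a b c x : ℝ} (hb : 0 < sn κ b) (hc : 0 < sn κ c) :
    x ≤ cosRatio κ a b c ↔ md κ a ≤ hingeMd κ b c x := by
  rw [cosRatio, le_div_iff₀ (mul_pos hb hc), hingeMd]
  constructor <;> intro h <;> linarith

section Triangle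

variable {κ a b c : ℝ}

/-- By `md_sub_md` both bounds are products of `sn` at half the perimeter, or at half the perimeter
minus a side; these arguments stay within `[0, π / √κ]` if `κ > 0`. -/
theorem cosRatio_mem_Icc (hb : 0 < b) (hc : 0 < c)
    (habc : a ≤ b + c) (hbac : b ≤ a + c) (hcab : c ≤ a + b)
    (h : 0 < κ → a + b + c < 2 * (π / √κ)) : cosRatio κ a b c ∈ Icc (-1) 1 := by
  have hsb : 0 < sn κ b := sn_pos hb fun hk => by have := h hk; linarith
  have hsc : 0 < sn κ c := sn_pos hc fun hk => by have := h hk; linarith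
  have nn : ∀ u : ℝ, 0 ≤ u → u ≤ (a + b + c) / 2 → 0 ≤ sn κ u := fun u hu hu' =>
    sn_nonneg hu fun hk => by have := h hk; linarith
  constructor
  · rw [le_cosRatio_iff hsb hsc]
    have h1 := md_add κ b c
    have h2 := md_sub_md κ (b + c) a
    have h3 : 0 ≤ sn κ ((b + c + a) / 2) := nn _ (by linarith) (by linarith)
    have h4 : 0 ≤ sn κ ((b + c - a) / 2) := nn _ (by linarith) (by linarith)
    rw [hingeMd]
    nlinarith [mul_nonneg h3 h4]
  · rw [cosRatio, div_le_one (mul_pos hsb hsc)]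
    have h1 := md_add κ b (-c)
    rw [sn_neg, md_neg] at h1
    have h2 := md_sub_md κ a (b + -c)
    have h3 : 0 ≤ sn κ ((a + (b + -c)) / 2) := nn _ (by linarith) (by linarith)
    have h4 : 0 ≤ sn κ ((a - (b + -c)) / 2) := nn _ (by linarith) (by linarith)
    nlinarith [mul_nonneg h3 h4]

end Triangle

theorem sn_add_mul_cs_sub (κ t s : ℝ) :
    sn κ (t + s) * cs κ t - sn κ s = sn κ t * cs κ (t + s) := by
  have h := sn_add κ (t + s) (-t)
  rw [sn_neg, cs_neg, show t + s + -t = s by ring] at h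
  linarith

theorem sn_mul_md_add (κ t s : ℝ) :
    sn κ t * md κ (t + s) = sn κ t * md κ s + sn κ s * md κ t + sn κ (t + s) * md κ t := by
  have h := md_add κ (t + s) (-t)
  have h0 := md_add κ t (-t)
  rw [sn_neg, md_neg, show t + s + -t = s by ring] at h
  rw [sn_neg, md_neg, add_neg_cancel, md_zero] at h0
  linear_combination -sn κ t * h + sn κ (t + s) * h0 + md κ t * sn_add_mul_cs_sub κ t s

/-- Alexandrov's lemma: if the model angles at an inner point of a side are adjacent, then the
model angle at an endpoint of this side decreases when the side is prolonged. -/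
theorem cosRatio_le_cosRatio_of_adjacent {κ a b c s t : ℝ} (ha : 0 < sn κ a) (hb : 0 < sn κ b)
    (hs : 0 < sn κ s) (ht : 0 < sn κ t) (hst : 0 < sn κ (t + s))
    (h : 0 ≤ cosRatio κ a t b + cosRatio κ c s b) :
    cosRatio κ b a t ≤ cosRatio κ c a (t + s) := by
  have e1 : cosRatio κ a t b + cosRatio κ c s b =
      (sn κ s * (md κ t + cs κ t * md κ b - md κ a) +
        sn κ t * (md κ s + cs κ s * md κ b - md κ c)) / (sn κ t * sn κ s * sn κ b) := by
    unfold cosRatio; field_simp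
  rw [e1, le_div_iff₀ (by positivity), zero_mul] at h
  rw [cosRatio_comm κ b, cosRatio_comm κ c]
  unfold cosRatio
  rw [div_le_div_iff₀ (by positivity) (by positivity), ← sub_nonneg]
  -- With denominators cleared, the difference of the two sides is `sn κ a` times the numerator in
  -- `h`.
  have key := mul_nonneg ha.le h
  refine key.trans_eq ?_
  linear_combination (-sn κ a) * sn_mul_md_add κ t s + sn κ a * md κ a * sn_add_mul_cs_sub κ t s
    - sn κ a * md κ b * sn_add κ t s

/-- The inequality between model hinges behind the step that moves the vertex of a hinge. -/
theorem hingeMd_le_hingeMd {κ a b c t s c' c'' e : ℝ} (ht : 0 < sn κ t) (hs : 0 ≤ sn κ s)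
    (hts : 0 ≤ sn κ (t + s)) (he : 0 ≤ sn κ e) (h1 : md κ e ≤ hingeMd κ a t c)
    (h2 : md κ a ≤ hingeMd κ e t c'') (h3 : 0 ≤ c'' + c') (hb : b = t + s) :
    hingeMd κ e s c' ≤ hingeMd κ a b c := by
  subst hb
  rw [hingeMd_comm] at h1 h2 ⊢
  rw [hingeMd_comm κ a]
  unfold hingeMd at *
  refine le_of_mul_le_mul_left ?_ ht
  -- The weights make `c''` cancel and give `c` and `c'` their coefficients in the goal; addition
  -- formulas do the rest.
  have k3 := mul_nonneg (mul_nonneg ht.le (mul_nonneg he hs)) h3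
  have k2 := mul_le_mul_of_nonneg_left h2 hs
  have k1 := mul_le_mul_of_nonneg_left h1 hts
  have i2 := sn_mul_md_add κ t s
  have i1 : md κ a * (sn κ (t + s) * cs κ t - sn κ s) = md κ a * (sn κ t * cs κ (t + s)) := by
    rw [sn_add_mul_cs_sub]
  have i3 : md κ e * sn κ (t + s) = md κ e * (sn κ t * cs κ s + cs κ t * sn κ s) := by
    rw [sn_add]
  linarith

/-! ### Model angles and Alexandrov's lemma in a metric space. -/

section ModelAngle

variable {X : Type*} [MetricSpace X] {κ : ℝ}

theorem modelAngle_eq_arccos (κ : ℝ) (p q r : X) :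
    modelAngle κ p q r = Real.arccos (cosRatio κ (dist q r) (dist p q) (dist p r)) :=
  modelAngleOfSides_eq_arccos _ _ _ _

theorem modelAngle_comm (κ : ℝ) (p q r : X) : modelAngle κ p q r = modelAngle κ p r q := by
  rw [modelAngle_eq_arccos, modelAngle_eq_arccos, cosRatio_comm, dist_comm q r]

theorem modelAngle_mem_Icc (κ : ℝ) (p q r : X) : modelAngle κ p q r ∈ Icc 0 π := by
  rw [modelAngle_eq_arccos]; exact ⟨Real.arccos_nonneg _, Real.arccos_le_pi _⟩

theorem ModelAngleDefined.sn_pos_left {p q r : X} (h : ModelAngleDefined κ p q r) :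
    0 < sn κ (dist p q) :=
  sn_pos h.1 fun hk => by
    have := h.2.2 hk
    have := dist_triangle p r q
    rw [dist_comm p r, dist_comm r q] at this
    linarith

theorem ModelAngleDefined.symm {p q r : X} (h : ModelAngleDefined κ p q r) :
    ModelAngleDefined κ p r q :=
  ⟨h.2.1, h.1, fun hk => by
    have := h.2.2 hk
    rw [dist_comm p r, dist_comm r q, dist_comm q p]; linarith⟩

theorem ModelAngleDefined.sn_pos_right {p q r : X} (h : ModelAngleDefined κ p q r) :
    0 < sn κ (dist p r) := h.symm.sn_pos_left

theorem ModelAngleDefined.cosRatio_mem_Icc {p q r : X} (h : ModelAngleDefined κ p q r) :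
    cosRatio κ (dist q r) (dist p q) (dist p r) ∈ Icc (-1) 1 := by
  refine _root_.cosRatio_mem_Icc h.1 h.2.1 ?_ ?_ ?_ fun hk => ?_
  · rw [dist_comm p q]; exact dist_triangle _ _ _
  · rw [add_comm, dist_comm q r]; exact dist_triangle _ _ _
  · rw [add_comm]; exact dist_triangle _ _ _
  · have := h.2.2 hk
    rw [dist_comm p r]; linarith

theorem ModelAngleDefined.cos_modelAngle {p q r : X} (h : ModelAngleDefined κ p q r) :
    Real.cos (modelAngle κ p q r) = cosRatio κ (dist q r) (dist p q) (dist p r) := by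
  rw [modelAngle_eq_arccos, Real.cos_arccos h.cosRatio_mem_Icc.1 h.cosRatio_mem_Icc.2]

theorem ModelAngleDefined.le_of_le_modelAngle {p q r : X} (h : ModelAngleDefined κ p q r) {θ : ℝ}
    (h1 : modelAngle κ p q r ≤ θ) (h2 : θ ≤ π) :
    md κ (dist q r) ≤ hingeMd κ (dist p q) (dist p r) (Real.cos θ) := by
  rw [← le_cosRatio_iff h.sn_pos_left h.sn_pos_right, ← h.cos_modelAngle]
  exact Real.cos_le_cos_of_nonneg_of_le_pi (modelAngle_mem_Icc _ _ _ _).1 h2 h1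

theorem ModelAngleDefined.modelAngle_le {p q r : X} (h : ModelAngleDefined κ p q r) {θ : ℝ}
    (h0 : 0 ≤ θ) (h2 : θ ≤ π)
    (h1 : md κ (dist q r) ≤ hingeMd κ (dist p q) (dist p r) (Real.cos θ)) :
    modelAngle κ p q r ≤ θ := by
  rw [← le_cosRatio_iff h.sn_pos_left h.sn_pos_right] at h1
  rw [modelAngle_eq_arccos, ← Real.arccos_cos h0 h2]
  exact Real.arccos_le_arccos h1

theorem modelAngle_eq_pi {p q r : X} (h : ModelAngleDefined κ p q r)
    (hd : dist q r = dist p q + dist p r) : modelAngle κ p q r = π := by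
  rw [modelAngle_eq_arccos, cosRatio, hd, md_add, Real.arccos_eq_pi,
    div_le_iff₀ (mul_pos h.sn_pos_left h.sn_pos_right)]
  linarith

theorem modelAngle_eq_zero {p q r : X} (h : ModelAngleDefined κ p q r)
    (hd : dist p r = dist p q + dist q r) : modelAngle κ p q r = 0 := by
  have h1 := md_add κ (dist p r) (-dist p q)
  rw [md_neg, sn_neg, show dist p r + -dist p q = dist q r by linarith] at h1
  rw [modelAngle_comm, modelAngle_eq_arccos, cosRatio, dist_comm r q, h1, Real.arccos_eq_zero,
    le_div_iff₀ (mul_pos h.sn_pos_right h.sn_pos_left)]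
  linarith

theorem cos_add_cos_nonneg {θ₁ θ₂ : ℝ} (h₁ : 0 ≤ θ₁) (h₂ : 0 ≤ θ₂) (h : θ₁ + θ₂ ≤ π) :
    0 ≤ Real.cos θ₁ + Real.cos θ₂ := by
  have := Real.cos_le_cos_of_nonneg_of_le_pi h₁ (by linarith) (by linarith : θ₁ ≤ π - θ₂)
  rw [Real.cos_pi_sub] at this
  linarith

/-- Since `y` lies between `x` and `z`, one model angle is π, which leaves at most π for the other
two. -/
theorem FourPointComparison.cosRatio_add_nonneg {p x y z : X} (h : FourPointComparison κ y x z p)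
    (h₁ : ModelAngleDefined κ y x z) (h₂ : ModelAngleDefined κ y z p)
    (h₃ : ModelAngleDefined κ y p x) (hd : dist x z = dist y x + dist y z) :
    0 ≤ cosRatio κ (dist x p) (dist y x) (dist y p) +
      cosRatio κ (dist z p) (dist y z) (dist y p) := by
  rcases h with h | h | h | h
  · rw [modelAngle_eq_pi h₁ hd] at h
    rw [← h₂.cos_modelAngle, ← h₃.symm.cos_modelAngle, modelAngle_comm κ y x p]
    exact cos_add_cos_nonneg (modelAngle_mem_Icc _ _ _ _).1 (modelAngle_mem_Icc _ _ _ _).1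
      (by linarith)
  all_goals contradiction

theorem FourPointComparison.modelAngle_le_modelAngle {p x y z : X}
    (h : FourPointComparison κ y x z p) (hyz : ModelAngleDefined κ y x z)
    (hyp : y ≠ p → ModelAngleDefined κ y z p ∧ ModelAngleDefined κ y p x)
    (hxz : ModelAngleDefined κ x p z) (hd : dist x z = dist x y + dist y z) :
    modelAngle κ x p z ≤ modelAngle κ x p y := by
  rcases eq_or_ne y p with rfl | hne
  · rw [modelAngle_eq_zero hxz hd]; exact (modelAngle_mem_Icc _ _ _ _).1
  · obtain ⟨h2, h3⟩ := hyp hne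
    have := h.cosRatio_add_nonneg hyz h2 h3 (by rw [hd, dist_comm x y])
    rw [modelAngle_eq_arccos, modelAngle_eq_arccos]
    refine Real.arccos_le_arccos ?_
    rw [hd, dist_comm x y, dist_comm p y, dist_comm p z]
    refine cosRatio_le_cosRatio_of_adjacent hxz.sn_pos_left h2.sn_pos_right h2.sn_pos_left
      hyz.sn_pos_left ?_ ?_
    · rw [dist_comm y x, ← hd]; exact hxz.sn_pos_right
    · exact this

end ModelAngle

/-! ### Geodesics and angles at small scale. -/

/-- `γ` is a unit-speed minimizing geodesic on `[0, D]`. -/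
def IsGeod {X : Type*} [MetricSpace X] (γ : ℝ → X) (D : ℝ) : Prop :=
  ∀ s ∈ Icc 0 D, ∀ t ∈ Icc 0 D, dist (γ s) (γ t) = |s - t|

/-- All quadruples of diameter controlled by `r` with first point in the ball of radius `R` at `o`
satisfy the four-point comparison. -/
def LocalComparison {X : Type*} [MetricSpace X] (κ : ℝ) (o : X) (R r : ℝ) : Prop :=
  ∀ p x₁ x₂ x₃ : X, dist p o < R → dist p x₁ < r → dist p x₂ < r → dist p x₃ < r →
    FourPointComparison κ p x₁ x₂ x₃

/-- The geodesics `α` and `β` make the angle `θ` at their common starting point. -/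
def HasAngle {X : Type*} [MetricSpace X] (κ : ℝ) (α β : ℝ → X) (θ : ℝ) : Prop :=
  Tendsto (fun s => modelAngle κ (α 0) (α s) (β s)) (𝓝[>] 0) (𝓝 θ)

section Angle

variable {X : Type*} [MetricSpace X] {κ : ℝ}

theorem modelAngleDefined_of_lt {p q r : X} {d : ℝ} (hd : 0 < κ → 2 * d ≤ π / √κ) (hq : 0 < dist p q)
    (hr : 0 < dist p r) (hq' : dist p q < d) (hr' : dist p r < d) :
    ModelAngleDefined κ p q r :=
  ⟨hq, hr, fun hk => by
    have := hd hk
    have := dist_triangle q p r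
    rw [dist_comm q p] at this
    rw [dist_comm r p]; linarith⟩

theorem IsGeod.dist_zero {γ : ℝ → X} {D t : ℝ} (h : IsGeod γ D) (h0 : 0 ≤ t) (ht : t ≤ D) :
    dist (γ 0) (γ t) = t := by
  rw [h 0 ⟨le_rfl, h0.trans ht⟩ t ⟨h0, ht⟩, zero_sub, abs_neg, abs_of_nonneg h0]

theorem IsGeod.dist_of_le {γ : ℝ → X} {D s t : ℝ} (h : IsGeod γ D) (h0 : 0 ≤ s) (hs : s ≤ t)
    (ht : t ≤ D) : dist (γ s) (γ t) = t - s := by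
  rw [h s ⟨h0, hs.trans ht⟩ t ⟨h0.trans hs, ht⟩, abs_sub_comm, abs_of_nonneg (by linarith)]

theorem IsGeod.mono {γ : ℝ → X} {D D' : ℝ} (h : IsGeod γ D) (hD : D' ≤ D) : IsGeod γ D' :=
  fun s hs t ht => h s ⟨hs.1, hs.2.trans hD⟩ t ⟨ht.1, ht.2.trans hD⟩

theorem IsGeod.shift {γ : ℝ → X} {D t : ℝ} (h : IsGeod γ D) (ht : 0 ≤ t) :
    IsGeod (fun s => γ (t + s)) (D - t) := fun s hs s' hs' => by
  rw [h _ ⟨by linarith [hs.1], by linarith [hs.2]⟩ _ ⟨by linarith [hs'.1], by linarith [hs'.2]⟩]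
  congr 1; ring

theorem IsGeod.reverse {γ : ℝ → X} {D t : ℝ} (h : IsGeod γ D) (ht : t ≤ D) :
    IsGeod (fun s => γ (t - s)) t := fun s hs s' hs' => by
  rw [h _ ⟨by linarith [hs.2], by linarith [hs.1]⟩ _ ⟨by linarith [hs'.2], by linarith [hs'.1]⟩,
    abs_sub_comm]
  congr 1; ring

variable {o : X} {R r : ℝ}

/-- Four-point comparison at the inner point `β t`, against `β 0`, `β t'` and `p`, is the hypothesis
of Alexandrov's lemma. -/
theorem LocalComparison.modelAngle_antitone_right (hL : LocalComparison κ o R r)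
    (hr : 0 < κ → 2 * r ≤ π / √κ) {β : ℝ → X} {B : ℝ} (hβ : IsGeod β B) {p : X}
    (ho : dist (β 0) o + r ≤ R) {t t' : ℝ} (ht : 0 < t) (htt : t ≤ t') (htB : t' ≤ B)
    (hp : 0 < dist (β 0) p) (hp' : dist (β 0) p + t' < r) :
    modelAngle κ (β 0) p (β t') ≤ modelAngle κ (β 0) p (β t) := by
  rcases htt.eq_or_lt with rfl | htt
  · rfl
  have e1 := hβ.dist_zero ht.le (htt.le.trans htB)
  have e2 := hβ.dist_zero (ht.le.trans htt.le) htB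
  have e3 := hβ.dist_of_le ht.le htt.le htB
  have e5 : dist (β t) (β 0) = t := by rw [dist_comm, e1]
  have e4 : dist (β t) p ≤ t + dist (β 0) p := by
    have := dist_triangle (β t) (β 0) p
    linarith
  have h4 : FourPointComparison κ (β t) (β 0) (β t') p := by
    refine hL _ _ _ _ ?_ ?_ ?_ ?_
    · have := dist_triangle (β t) (β 0) o
      linarith
    all_goals linarith
  refine h4.modelAngle_le_modelAngle (modelAngleDefined_of_lt hr ?_ ?_ ?_ ?_) (fun hne => ?_)
    (modelAngleDefined_of_lt hr ?_ ?_ ?_ ?_) ?_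
  on_goal 5 =>
    have := dist_pos.2 hne
    constructor <;> refine modelAngleDefined_of_lt hr ?_ ?_ ?_ ?_
  all_goals linarith

theorem LocalComparison.modelAngle_antitone (hL : LocalComparison κ o R r)
    (hr : 0 < κ → 2 * r ≤ π / √κ) {α β : ℝ → X} {A B : ℝ} (hα : IsGeod α A) (hβ : IsGeod β B)
    (h0 : α 0 = β 0) (ho : dist (α 0) o + r ≤ R) {s s' t t' : ℝ} (hs : 0 < s) (hss : s ≤ s')
    (hsA : s' ≤ A) (ht : 0 < t) (htt : t ≤ t') (htB : t' ≤ B) (hst : s' + t' < r) :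
    modelAngle κ (α 0) (α s') (β t') ≤ modelAngle κ (α 0) (α s) (β t) := by
  have e1 := hα.dist_zero hs.le (hss.trans hsA)
  have e2 := hβ.dist_zero (ht.le.trans htt) htB
  have e3 := hα.dist_zero (hs.le.trans hss) hsA
  calc modelAngle κ (α 0) (α s') (β t') = modelAngle κ (α 0) (β t') (α s') := modelAngle_comm ..
    _ ≤ modelAngle κ (α 0) (β t') (α s) :=
        hL.modelAngle_antitone_right hr hα ho hs hss hsA (by rw [h0]; linarith)
          (by rw [h0]; linarith)
    _ = modelAngle κ (β 0) (α s) (β t') := by rw [modelAngle_comm, h0]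
    _ ≤ modelAngle κ (β 0) (α s) (β t) :=
        hL.modelAngle_antitone_right hr hβ (by rwa [← h0]) ht htt htB
          (by rw [← h0]; linarith) (by rw [← h0]; linarith)
    _ = _ := by rw [h0]

theorem HasAngle.mem_Icc {α β : ℝ → X} {θ : ℝ} (h : HasAngle κ α β θ) : θ ∈ Icc 0 π :=
  isClosed_Icc.mem_of_tendsto h (Eventually.of_forall fun _ => modelAngle_mem_Icc ..)

theorem HasAngle.symm {α β : ℝ → X} {θ : ℝ} (h : HasAngle κ α β θ) (h0 : α 0 = β 0) :
    HasAngle κ β α θ := by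
  unfold HasAngle at *
  simpa only [modelAngle_comm κ (β 0) , h0] using h

theorem LocalComparison.exists_hasAngle (hL : LocalComparison κ o R r)
    (hr : 0 < κ → 2 * r ≤ π / √κ) (hr0 : 0 < r) {α β : ℝ → X} {A B : ℝ} (hα : IsGeod α A)
    (hβ : IsGeod β B) (hA : 0 < A) (hB : 0 < B) (h0 : α 0 = β 0) (ho : dist (α 0) o + r ≤ R) :
    ∃ θ, HasAngle κ α β θ := by
  set c := min (min A B) (r / 3) with hc
  have hc0 : 0 < c := by positivity
  have hcA : c ≤ A := (min_le_left _ _).trans (min_le_left _ _)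
  have hcB : c ≤ B := (min_le_left _ _).trans (min_le_right _ _)
  have hcr : c ≤ r / 3 := min_le_right _ _
  have anti : AntitoneOn (fun s => modelAngle κ (α 0) (α s) (β s)) (Ioo 0 c) := by
    intro s hs t ht hst
    exact hL.modelAngle_antitone hr hα hβ h0 ho hs.1 hst (ht.2.le.trans hcA) hs.1 hst
      (ht.2.le.trans hcB) (by linarith [ht.2])
  have := anti.tendsto_nhdsWithin_Ioo_right (nonempty_Ioo.2 hc0)
    ⟨π, by rintro _ ⟨s, -, rfl⟩; exact (modelAngle_mem_Icc ..).2⟩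
  exact ⟨_, this⟩

/-- The angle is the limit of model angles that increase as the sides shrink, so it dominates the
model angle of the whole hinge. -/
theorem LocalComparison.hinge_le (hL : LocalComparison κ o R r)
    (hr : 0 < κ → 2 * r ≤ π / √κ) {α β : ℝ → X} {A B θ : ℝ} (hα : IsGeod α A)
    (hβ : IsGeod β B) (hA : 0 < A) (hB : 0 < B) (h0 : α 0 = β 0) (ho : dist (α 0) o + r ≤ R)
    (hAB : A + B < r) (hθ : HasAngle κ α β θ) :
    md κ (dist (α A) (β B)) ≤ hingeMd κ A B (Real.cos θ) := by
  have e1 := hα.dist_zero hA.le le_rfl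
  have e2 := hβ.dist_zero hB.le le_rfl
  have h1 : modelAngle κ (α 0) (α A) (β B) ≤ θ := by
    refine ge_of_tendsto hθ ?_
    filter_upwards [Ioo_mem_nhdsGT (lt_min hA hB)] with s hs
    exact hL.modelAngle_antitone hr hα hβ h0 ho hs.1 (hs.2.le.trans (min_le_left _ _)) le_rfl
      hs.1 (hs.2.le.trans (min_le_right _ _)) le_rfl hAB
  have h2 : ModelAngleDefined κ (α 0) (α A) (β B) := by
    have : dist (α 0) (β B) = B := by rw [h0, e2]
    refine modelAngleDefined_of_lt hr ?_ ?_ ?_ ?_ <;> linarith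
  have h3 := h2.le_of_le_modelAngle h1 hθ.mem_Icc.2
  rwa [e1, h0, e2] at h3

theorem LocalComparison.angle_add_angle_add_angle_le (hL : LocalComparison κ o R r)
    (hr : 0 < κ → 2 * r ≤ π / √κ) (hr0 : 0 < r) {α β γ : ℝ → X} {A B C θ₁ θ₂ θ₃ : ℝ}
    (hα : IsGeod α A) (hβ : IsGeod β B) (hγ : IsGeod γ C) (hA : 0 < A) (hB : 0 < B) (hC : 0 < C)
    (hαβ : α 0 = β 0) (hβγ : β 0 = γ 0) (ho : dist (α 0) o < R)
    (h₁ : HasAngle κ α β θ₁) (h₂ : HasAngle κ β γ θ₂) (h₃ : HasAngle κ γ α θ₃) :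
    θ₁ + θ₂ + θ₃ ≤ 2 * π := by
  refine le_of_tendsto ((h₁.add h₂).add h₃) ?_
  filter_upwards [Ioo_mem_nhdsGT (lt_min (lt_min hA hB) (lt_min hC hr0))] with s hs
  obtain ⟨hs0, hs⟩ := hs
  simp only [lt_min_iff] at hs
  have e1 := hα.dist_zero hs0.le hs.1.1.le
  have e2 := hβ.dist_zero hs0.le hs.1.2.le
  have e3 := hγ.dist_zero hs0.le hs.2.1.le
  rw [← hβγ] at e3 ⊢
  rw [← hαβ] at e2 e3 ⊢
  rcases hL (α 0) (α s) (β s) (γ s) ho (by linarith) (by linarith) (by linarith) with h | h | h | h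
  · exact h
  all_goals
    refine absurd (modelAngleDefined_of_lt hr ?_ ?_ ?_ ?_) h <;> linarith

/-- The two directions of `β` at an inner point make the angle π, so their angles with `δ` sum to at
most π. -/
theorem LocalComparison.cos_add_cos_nonneg (hL : LocalComparison κ o R r)
    (hr : 0 < κ → 2 * r ≤ π / √κ) (hr0 : 0 < r) {β δ : ℝ → X} {B t e θ₁ θ₂ : ℝ}
    (hβ : IsGeod β B) (ht : 0 < t) (htB : t < B) (hδ : IsGeod δ e) (he : 0 < e)
    (h0 : δ 0 = β t) (ho : dist (β t) o < R)
    (h₁ : HasAngle κ δ (fun s => β (t - s)) θ₁) (h₂ : HasAngle κ δ (fun s => β (t + s)) θ₂) :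
    0 ≤ Real.cos θ₁ + Real.cos θ₂ := by
  have h₃ : HasAngle κ (fun s => β (t - s)) (fun s => β (t + s)) π := by
    refine tendsto_const_nhds.congr' ?_
    filter_upwards [Ioo_mem_nhdsGT (lt_min (lt_min ht (sub_pos.2 htB)) hr0)] with s hs
    obtain ⟨hs0, hs⟩ := hs
    simp only [lt_min_iff] at hs
    have e1 := hβ.dist_of_le (s := t - s) (t := t) (by linarith) (by linarith) (by linarith)
    have e2 := hβ.dist_of_le (s := t) (t := t + s) (by linarith) (by linarith) (by linarith)
    have e3 := hβ.dist_of_le (s := t - s) (t := t + s) (by linarith) (by linarith) (by linarith)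
    rw [dist_comm] at e1
    simp only [sub_zero]
    refine (modelAngle_eq_pi (modelAngleDefined_of_lt hr ?_ ?_ ?_ ?_) ?_).symm <;> linarith
  have := hL.angle_add_angle_add_angle_le hr hr0 hδ (hβ.reverse htB.le) (hβ.shift ht.le) he ht
    (sub_pos.2 htB) (by simpa using h0) (by simp) (by rwa [h0]) h₁ h₃ (h₂.symm (by simpa using h0))
  exact _root_.cos_add_cos_nonneg h₁.mem_Icc.1 h₂.mem_Icc.1 (by linarith)

end Angle

/-! ### Propagation of hinge comparison to large hinges. -/

/-- A hinge whose third side is almost as long as possible satisfies hinge comparison up to a small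
error. -/
theorem exists_md_add_le_hingeMd_add {κ t ε : ℝ} (B : ℝ) (ht : 0 < sn κ t) (hε : 0 < ε) :
    ∃ δ > 0, ∀ a b e c : ℝ, b ∈ Icc 0 B → 0 ≤ sn κ b → (a + t + e) / 2 ∈ Icc 0 B →
      |a + t - e| < δ → md κ e ≤ hingeMd κ a t c → md κ (a + b) ≤ hingeMd κ a b c + ε := by
  obtain ⟨C, hC⟩ := (isCompact_Icc (a := (0 : ℝ)) (b := B)).exists_bound_of_continuousOn
    (continuous_sn κ).continuousOn
  set D := max C 1
  have hD : 0 < D := lt_max_of_lt_right one_pos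
  have hCD : ∀ u ∈ Icc 0 B, |sn κ u| ≤ D := fun u hu => (hC u hu).trans (le_max_left _ _)
  have hη : 0 < ε * sn κ t / (2 * D ^ 2) := by positivity
  obtain ⟨δ, hδ, h⟩ := Metric.continuousAt_iff.1 (continuous_sn κ).continuousAt _ hη
  refine ⟨δ, hδ, fun a b e c hb hb0 hu hd hmd => ?_⟩
  have hv : |sn κ ((a + t - e) / 2)| < ε * sn κ t / (2 * D ^ 2) := by
    have := h (x := (a + t - e) / 2) (by
      rw [Real.dist_eq, sub_zero, abs_div, abs_two]
      linarith [abs_nonneg (a + t - e)])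
    rwa [Real.dist_eq, sn_zero, sub_zero] at this
  have e1 := md_add_sub_hingeMd κ a b c
  have e2 := md_add_sub_hingeMd κ a t c
  have e3 := md_sub_md κ (a + t) e
  -- The hinges `(a, b)` and `(a, t)` share a side and the angle, so their defects are in the ratio
  -- `sn κ b : sn κ t`; the second is small because `e` is close to `a + t`.
  have h1 : sn κ t * (md κ (a + b) - hingeMd κ a b c) ≤ sn κ b * (md κ (a + t) - md κ e) := by
    calc _ = sn κ b * (md κ (a + t) - hingeMd κ a t c) := by rw [e1, e2]; ring
      _ ≤ _ := by gcongr
  have h2 : sn κ b * (md κ (a + t) - md κ e) ≤ ε * sn κ t := by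
    rw [e3]
    refine (le_abs_self _).trans ?_
    rw [abs_mul, abs_mul, abs_mul, abs_two]
    calc _ ≤ D * (2 * (D * (ε * sn κ t / (2 * D ^ 2)))) := by
          gcongr
          exacts [hCD _ hb, hCD _ hu]
      _ = _ := by field_simp
  have h3 : sn κ t * (md κ (a + b) - hingeMd κ a b c) ≤ sn κ t * ε := by linarith
  linarith [le_of_mul_le_mul_left h3 ht]

/-- Hinge comparison for hinges of size less than `ℓ` with vertex in the ball of radius `R`. -/
def HingeComparison {X : Type*} [MetricSpace X] (κ : ℝ) (o : X) (R ℓ : ℝ) : Prop :=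
  ∀ (α β : ℝ → X) (a b θ : ℝ), 0 < a → 0 < b → IsGeod α a → IsGeod β b → α 0 = β 0 →
    dist (α 0) o < R → a + b < ℓ → HasAngle κ α β θ →
    md κ (dist (α a) (β b)) ≤ hingeMd κ a b (Real.cos θ)

/-- Any two points are joined by a minimizing geodesic. -/
def IsGeodesicSpace (X : Type*) [MetricSpace X] : Prop :=
  ∀ x y : X, ∃ γ : ℝ → X, IsGeod γ (dist x y) ∧ γ 0 = x ∧ γ (dist x y) = y

section Hinge

variable {X : Type*} [MetricSpace X] {κ : ℝ} {o : X} {R R' r ℓ : ℝ}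

theorem HingeComparison.mono (h : HingeComparison κ o R ℓ) {ℓ' : ℝ} (hR : R' ≤ R)
    (hℓ : ℓ' ≤ ℓ) : HingeComparison κ o R' ℓ' :=
  fun α β a b θ ha hb hα hβ h0 ho hab hθ =>
    h α β a b θ ha hb hα hβ h0 (ho.trans_le hR) (hab.trans_le hℓ) hθ

theorem LocalComparison.hingeComparison (hL : LocalComparison κ o R r)
    (hr : 0 < κ → 2 * r ≤ π / √κ) (hR : R' + r ≤ R) : HingeComparison κ o R' r :=
  fun _ _ _ _ _ ha hb hα hβ h0 ho hab hθ =>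
    hL.hinge_le hr hα hβ ha hb h0 (by linarith) hab hθ

/-- Moving the vertex of a hinge along one of its sides. -/
theorem HingeComparison.step (hX : IsGeodesicSpace X) (hL : LocalComparison κ o R r)
    (hr : 0 < κ → 2 * r ≤ π / √κ) (hr0 : 0 < r) (hR : R' + r ≤ R)
    (hK : HingeComparison κ o R' ℓ) {α β : ℝ → X} {a b θ t : ℝ} (ha : 0 < a)
    (hα : IsGeod α a) (hβ : IsGeod β b) (h0 : α 0 = β 0) (ho : dist (α 0) o < R')
    (hθ : HasAngle κ α β θ) (ht : 0 < t) (htb : t < b) (ho' : dist (β t) o < R')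
    (h1 : a + t < ℓ) (h2 : dist (β t) (α a) + t < ℓ) (hb : 0 < κ → b ≤ π / √κ)
    (he : 0 < κ → dist (β t) (α a) ≤ π / √κ) :
    md κ (dist (α a) (β b)) ≤ hingeMd κ a b (Real.cos θ) ∨
    ∃ (δ : ℝ → X) (θ' : ℝ), 0 < dist (β t) (α a) ∧ IsGeod δ (dist (β t) (α a)) ∧ δ 0 = β t ∧
      δ (dist (β t) (α a)) = α a ∧ HasAngle κ δ (fun s => β (t + s)) θ' ∧
      hingeMd κ (dist (β t) (α a)) (b - t) (Real.cos θ') ≤ hingeMd κ a b (Real.cos θ) := by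
  have hsn : ∀ u, 0 ≤ u → u ≤ b → 0 ≤ sn κ u := fun u hu hub =>
    sn_nonneg hu fun hk => hub.trans (hb hk)
  have hst : 0 < sn κ t := sn_pos ht fun hk => htb.trans_le (hb hk)
  have hsb : 0 ≤ sn κ (t + (b - t)) := hsn _ (by linarith) (by linarith)
  have hs : 0 ≤ sn κ (b - t) := hsn _ (by linarith) (by linarith)
  have k1 := hK α β a t θ ha ht hα (hβ.mono htb.le) h0 ho h1 hθ
  rw [dist_comm] at k1
  have ea := hα.dist_zero ha.le le_rfl
  obtain ⟨δ, hδ, hδ0, hδe⟩ := hX (β t) (α a)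
  rcases (dist_nonneg (x := β t) (y := α a)).eq_or_lt with he0 | he0
  · left
    -- Here the end of `α` lies on `β` and there is no new hinge; the same inequality with `e = 0`
    -- gives the comparison directly.
    have hpt : β t = α a := dist_eq_zero.1 he0.symm
    have eb := hβ.dist_of_le ht.le htb.le le_rfl
    have et := hβ.dist_zero ht.le htb.le
    rw [← h0, hpt, ea] at et
    rw [← he0] at k1
    have := hingeMd_le_hingeMd (e := 0) (c' := 0) (c'' := 0) hst hs hsb (sn_zero κ).ge k1
      (by simp [hingeMd, md_zero, cs_eq_one_sub, et]) (by simp) (by ring : b = t + (b - t))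
    rw [← hpt, eb]
    simpa [hingeMd, md_zero, cs_eq_one_sub, sn_zero] using this
  · right
    have hβ' := hβ.reverse htb.le
    have hor : dist (δ 0) o + r ≤ R := by rw [hδ0]; linarith
    obtain ⟨θ', hθ'⟩ := hL.exists_hasAngle hr hr0 hδ (hβ.shift ht.le) he0 (sub_pos.2 htb)
      (by simpa using hδ0) hor
    obtain ⟨θ'', hθ''⟩ := hL.exists_hasAngle hr hr0 hδ hβ' he0 ht (by simpa using hδ0) hor
    have k2 := hK δ _ _ t θ'' he0 ht hδ hβ' (by simpa using hδ0) (by rwa [hδ0]) h2 hθ''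
    simp only [sub_self, hδe] at k2
    rw [dist_comm, ← h0, ea] at k2
    have k3 := hL.cos_add_cos_nonneg hr hr0 hβ ht htb hδ he0 hδ0 (by linarith) hθ'' hθ'
    exact ⟨δ, θ', he0, hδ, hδ0, hδe, hθ',
      hingeMd_le_hingeMd hst hs hsb (sn_nonneg he0.le he) k1 k2 k3 (by ring)⟩

/-- Induction on the number of moves, each shortening the hinge by at least `δ`. The far endpoints
never move, so the balls are prescribed for them and not for the vertex. -/
theorem HingeComparison.approx (hX : IsGeodesicSpace X) (hL : LocalComparison κ o R r)
    (hr : 0 < κ → 2 * r ≤ π / √κ) (hr0 : 0 < r) (hR : R' + r ≤ R) (hℓ : 0 < ℓ)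
    (hK : HingeComparison κ o R' ℓ) (hℓκ : 0 < κ → 3 / 2 * ℓ ≤ π / √κ) {ε : ℝ} (hε : 0 < ε) :
    ∃ δ > 0, ∀ (N : ℕ) (α β : ℝ → X) (a b θ : ℝ), 0 < a → 0 < b → IsGeod α a → IsGeod β b →
      α 0 = β 0 → dist (α a) o < R' - 2 * ℓ → dist (β b) o < R' - 2 * ℓ → a + b < ℓ + N * δ →
      a + b < 3 / 2 * ℓ → HasAngle κ α β θ →
      md κ (dist (α a) (β b)) ≤ hingeMd κ a b (Real.cos θ) + ε := by
  have hst : 0 < sn κ (ℓ / 8) :=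
    sn_pos (by positivity) fun hk => lt_of_lt_of_le (by linarith) (hℓκ hk)
  obtain ⟨δ, hδ, H⟩ := exists_md_add_le_hingeMd_add (2 * ℓ) hst hε
  refine ⟨δ, hδ, fun N => ?_⟩
  induction N with
  | zero =>
    intro α β a b θ ha hb hα hβ h0 hoa hob hab hab' hθ
    have ea := hα.dist_zero ha.le le_rfl
    have := dist_triangle (α 0) (α a) o
    have := hK α β a b θ ha hb hα hβ h0 (by linarith) (by simpa using hab) hθ
    linarith
  | succ N ih =>
    intro α β a b θ ha hb hα hβ h0 hoa hob hab hab' hθ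
    wlog hle : a ≤ b generalizing α β a b
    · have := this β α b a hb ha hβ hα h0.symm hob hoa (by linarith) (by linarith) (hθ.symm h0)
        (by linarith)
      rwa [dist_comm, hingeMd_comm] at this
    have ea := hα.dist_zero ha.le le_rfl
    have eb := hβ.dist_zero hb.le le_rfl
    have ho : dist (α 0) o < R' := by
      have := dist_triangle (α 0) (α a) o
      linarith
    rcases lt_or_ge (a + b) ℓ with hs | hs
    · have := hK α β a b θ ha hb hα hβ h0 ho hs hθ
      linarith
    have et := hβ.dist_zero (t := ℓ / 8) (by linarith) (by linarith)
    have etb := hβ.dist_of_le (s := ℓ / 8) (t := b) (by linarith) (by linarith) le_rfl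
    have he : dist (β (ℓ / 8)) (α a) ≤ a + ℓ / 8 := by
      have := dist_triangle (β (ℓ / 8)) (β 0) (α a)
      rw [dist_comm _ (β 0), ← h0, ea, h0, et] at this
      linarith
    have ho' : dist (β (ℓ / 8)) o < R' := by
      have := dist_triangle (β (ℓ / 8)) (β b) o
      linarith
    rcases hK.step hX hL hr hr0 hR ha hα hβ h0 ho hθ (t := ℓ / 8) (by linarith) (by linarith) ho'
      (by linarith) (by linarith) (fun hk => by linarith [hℓκ hk]) (fun hk => by linarith [hℓκ hk])
      with h | ⟨γ, θ', he0, hγ, hγ0, hγe, hθ', hle'⟩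
    · linarith
    -- This excess is exactly what the move takes off the size of the hinge.
    rcases lt_or_ge (a + ℓ / 8 - dist (β (ℓ / 8)) (α a)) δ with hd | hd
    · have k1 := hK α β a (ℓ / 8) θ ha (by linarith) hα (hβ.mono (by linarith)) h0 ho
        (by linarith) hθ
      rw [dist_comm] at k1
      have k2 := H a b _ _ ⟨hb.le, by linarith⟩
        (sn_nonneg hb.le fun hk => by linarith [hℓκ hk]) ⟨by positivity, by linarith⟩
        (by rwa [abs_of_nonneg (by linarith)]) k1
      refine le_trans (md_le_md dist_nonneg ?_ fun hk => by linarith [hℓκ hk]) k2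
      have := dist_triangle (α a) (α 0) (β b)
      rw [dist_comm (α a) (α 0), ea, h0, eb] at this
      exact this
    · have := ih γ (fun s => β (ℓ / 8 + s)) _ (b - ℓ / 8) θ' he0 (by linarith) hγ
        (hβ.shift (by linarith)) (by simpa using hγ0) (by rwa [hγe]) (by simpa using hob)
        (by push_cast at hab; linarith) (by linarith) hθ'
      simp only [hγe, add_sub_cancel] at this
      linarith

/-- The key lemma: hinge comparison propagates to hinges of larger size. -/
theorem HingeComparison.enlarge (hX : IsGeodesicSpace X) (hL : LocalComparison κ o R r)
    (hr : 0 < κ → 2 * r ≤ π / √κ) (hr0 : 0 < r) (hR : R' + r ≤ R) (hℓ : 0 < ℓ)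
    (hK : HingeComparison κ o R' ℓ) (hℓκ : 0 < κ → 3 / 2 * ℓ ≤ π / √κ) :
    HingeComparison κ o (R' - 4 * ℓ) (3 / 2 * ℓ) := by
  intro α β a b θ ha hb hα hβ h0 ho hab hθ
  refine le_of_forall_pos_le_add fun ε hε => ?_
  obtain ⟨δ, hδ, H⟩ := hK.approx hX hL hr hr0 hR hℓ hℓκ hε
  obtain ⟨N, hN⟩ := exists_nat_gt (ℓ / δ)
  rw [div_lt_iff₀ hδ] at hN
  have ea := hα.dist_zero ha.le le_rfl
  have eb := hβ.dist_zero hb.le le_rfl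
  have h1 := dist_triangle (α a) (α 0) o
  have h2 := dist_triangle (β b) (β 0) o
  rw [dist_comm (α a) (α 0), ea] at h1
  rw [dist_comm (β b) (β 0), eb, ← h0] at h2
  exact H N α β a b θ ha hb hα hβ h0 (by linarith) (by linarith) (by linarith) hab hθ

/-- One enlargement costs `4ℓ = 8 (3ℓ/2 - ℓ)` of radius, so the losses telescope. -/
theorem HingeComparison.enlarge_iterate (hX : IsGeodesicSpace X) (hL : LocalComparison κ o R r)
    (hr : 0 < κ → 2 * r ≤ π / √κ) (hr0 : 0 < r) (n : ℕ) (hℓ : 0 < ℓ)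
    (hR : R' + 8 * ((3 / 2) ^ n * ℓ - ℓ) + r ≤ R) (hℓκ : 0 < κ → (3 / 2) ^ n * ℓ ≤ π / √κ)
    (hK : HingeComparison κ o (R' + 8 * ((3 / 2) ^ n * ℓ - ℓ)) ℓ) :
    HingeComparison κ o R' ((3 / 2) ^ n * ℓ) := by
  induction n generalizing ℓ with
  | zero => simpa using hK
  | succ n ih =>
    have e : (3 / 2 : ℝ) ^ (n + 1) * ℓ = (3 / 2) ^ n * (3 / 2 * ℓ) := by ring
    have hp : (1 : ℝ) ≤ (3 / 2) ^ n := one_le_pow₀ (by norm_num)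
    rw [e] at hR hℓκ hK ⊢
    have := hK.enlarge hX hL hr hr0 hR hℓ fun hk => le_trans (by nlinarith) (hℓκ hk)
    refine ih (by linarith) (by linarith) hℓκ (this.mono ?_ le_rfl)
    linarith

/-- Hinge comparison for hinges of restricted size implies hinge comparison for all hinges of
restricted perimeter. -/
theorem HingeComparison.of_perimeter_lt (hX : IsGeodesicSpace X) (hL : LocalComparison κ o R r)
    (hr : 0 < κ → 2 * r ≤ π / √κ) (hr0 : 0 < r) (hR : R' + r ≤ R)
    (hK : HingeComparison κ o R' ℓ) (hℓκ : 0 < κ → ℓ ≤ π / √κ) {h : ℝ} (hh : 0 < h) (N : ℕ)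
    (α β : ℝ → X) (a b θ : ℝ) (ha : 0 < a) (hb : 0 < b) (hα : IsGeod α a) (hβ : IsGeod β b)
    (h0 : α 0 = β 0) (ho : dist (α a) o < R' - ℓ) (hbN : b ≤ N * h)
    (hP : (a + b + dist (α a) (β b)) / 2 + h < ℓ) (hθ : HasAngle κ α β θ) :
    md κ (dist (α a) (β b)) ≤ hingeMd κ a b (Real.cos θ) := by
  -- Moving the vertex by `h` shortens `b` without increasing the perimeter or changing the third
  -- side. The auxiliary hinges fit below `ℓ` because no side exceeds half the perimeter.
  induction N generalizing α β a b θ with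
  | zero => simp at hbN; linarith
  | succ N ih =>
    have ea := hα.dist_zero ha.le le_rfl
    have eb := hβ.dist_zero hb.le le_rfl
    have ha2 : a ≤ b + dist (α a) (β b) := by
      have := dist_triangle (α 0) (β b) (α a)
      rw [ea, h0, eb, dist_comm] at this
      exact this
    have hb2 : b ≤ a + dist (α a) (β b) := by
      have := dist_triangle (β 0) (α a) (β b)
      rwa [← h0, ea, h0, eb] at this
    have hoo : dist (α 0) o < R' := by
      have := dist_triangle (α 0) (α a) o
      linarith
    rcases le_or_gt b h with hbh | hbh
    · exact hK α β a b θ ha hb hα hβ h0 hoo (by linarith) hθ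
    have et := hβ.dist_zero hh.le hbh.le
    have etb := hβ.dist_of_le hh.le hbh.le le_rfl
    have he : dist (β h) (α a) ≤ h + a := by
      have := dist_triangle (β h) (β 0) (α a)
      rwa [dist_comm _ (β 0), ← h0, ea, h0, et] at this
    have he' : dist (β h) (α a) ≤ (b - h) + dist (α a) (β b) := by
      have := dist_triangle (β h) (β b) (α a)
      rwa [etb, dist_comm (β b)] at this
    have ho' : dist (β h) o < R' := by
      have := dist_triangle (β h) (α a) o
      linarith
    rcases hK.step hX hL hr hr0 hR ha hα hβ h0 hoo hθ hh hbh ho' (by linarith) (by linarith)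
      (fun hk => by linarith [hℓκ hk]) (fun hk => by linarith [hℓκ hk])
      with h' | ⟨γ, θ', he0, hγ, hγ0, hγe, hθ', hle'⟩
    · exact h'
    have := ih γ (fun s => β (h + s)) _ (b - h) θ' he0 (by linarith) hγ
      (hβ.shift hh.le) (by simpa using hγ0) (by rwa [hγe]) (by push_cast at hbN; linarith)
      (by simp only [hγe, add_sub_cancel]; linarith) hθ'
    simp only [hγe, add_sub_cancel] at this
    linarith

/-- In a geodesic space, four-point comparison on small scale in a large ball implies four-point
comparison on a smaller ball. -/
theorem LocalComparison.fourPointComparison (hX : IsGeodesicSpace X) {ρ : ℝ} (hr0 : 0 < r)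
    (hL : LocalComparison κ o (100 * ρ) r) {p x₁ x₂ x₃ : X} (hp : dist p o < ρ)
    (h₁ : dist x₁ o < ρ) (h₂ : dist x₂ o < ρ) (h₃ : dist x₃ o < ρ) :
    FourPointComparison κ p x₁ x₂ x₃ := by
  have hρ : 0 < ρ := dist_nonneg.trans_lt hp
  -- Triangles in the ball have perimeter below `6ρ`; `L` exceeds every admissible half-perimeter
  -- without passing `π / √κ`.
  obtain ⟨L, hL0, hLρ, hLκ, hLP⟩ : ∃ L, 0 < L ∧ L ≤ 8 * ρ ∧ (0 < κ → L ≤ π / √κ) ∧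
      ∀ P, P < 6 * ρ → (0 < κ → P < 2 * (π / √κ)) → P / 2 < L := by
    by_cases hk : 0 < κ
    · have := div_pos Real.pi_pos (Real.sqrt_pos.2 hk)
      refine ⟨min (8 * ρ) (π / √κ), by positivity, min_le_left _ _, fun _ => min_le_right _ _,
        fun P h h' => lt_min (by linarith) (by linarith [h' hk])⟩
    · exact ⟨8 * ρ, by positivity, le_rfl, fun h => absurd h hk, fun P h _ => by linarith⟩
  obtain ⟨d, hd0, hdr, hdρ, hdκ⟩ : ∃ d, 0 < d ∧ d ≤ r ∧ d ≤ ρ ∧ (0 < κ → 2 * d ≤ π / √κ) :=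
    ⟨min (min r ρ) (L / 2), by positivity, (min_le_left _ _).trans (min_le_left _ _),
      (min_le_left _ _).trans (min_le_right _ _), fun hk => by
        have := min_le_right (min r ρ) (L / 2)
        linarith [hLκ hk]⟩
  have hLd : LocalComparison κ o (100 * ρ) d := fun q y₁ y₂ y₃ h h1 h2 h3 =>
    hL q y₁ y₂ y₃ h (h1.trans_le hdr) (h2.trans_le hdr) (h3.trans_le hdr)
  -- Starting from `(2/3)^n L < d`, exactly `n` enlargements end at `L`. The radius needed is at
  -- most `30ρ + 8L + d ≤ 95ρ`.
  obtain ⟨n, hn⟩ := exists_pow_lt_of_lt_one (div_pos hd0 hL0) (by norm_num : (2 / 3 : ℝ) < 1)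
  rw [lt_div_iff₀ hL0] at hn
  have hnL : (3 / 2 : ℝ) ^ n * ((2 / 3) ^ n * L) = L := by
    rw [← mul_assoc, ← mul_pow]; norm_num
  have hℓ : 0 < (2 / 3 : ℝ) ^ n * L := by positivity
  have hK : HingeComparison κ o (30 * ρ) L := by
    have := HingeComparison.enlarge_iterate (R' := 30 * ρ) (ℓ := (2 / 3 : ℝ) ^ n * L) hX hLd hdκ hd0
      n hℓ (by rw [hnL]; linarith) (by rwa [hnL])
      ((hLd.hingeComparison hdκ (by rw [hnL]; linarith)).mono le_rfl hn.le)
    rwa [hnL] at this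
  have key : ∀ x y : X, dist x o < ρ → dist y o < ρ → ModelAngleDefined κ p x y →
      ∀ (α β : ℝ → X) (θ : ℝ), IsGeod α (dist p x) → IsGeod β (dist p y) → α 0 = p → β 0 = p →
      α (dist p x) = x → β (dist p y) = y → HasAngle κ α β θ → modelAngle κ p x y ≤ θ := by
    intro x y hx hy hxy α β θ hα hβ hα0 hβ0 hαx hβy hθ
    refine hxy.modelAngle_le hθ.mem_Icc.1 hθ.mem_Icc.2 ?_
    have hP := hLP (dist p x + dist p y + dist x y) (by
      have t1 := dist_triangle_right p x o
      have t2 := dist_triangle_right p y o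
      have t3 := dist_triangle_right x y o
      linarith) (fun hk => by have := hxy.2.2 hk; rw [dist_comm y p] at this; linarith)
    have hh : 0 < (L - (dist p x + dist p y + dist x y) / 2) / 2 := by linarith
    obtain ⟨N, hN⟩ := exists_nat_gt (dist p y / ((L - (dist p x + dist p y + dist x y) / 2) / 2))
    rw [div_lt_iff₀ hh] at hN
    have := hK.of_perimeter_lt hX hLd hdκ hd0 (by linarith) hLκ hh N α β _ _ θ hxy.1 hxy.2.1 hα hβ
      (by rw [hα0, hβ0]) (by rw [hαx]; linarith) hN.le (by rw [hαx, hβy]; linarith) hθ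
    rwa [hαx, hβy] at this
  by_cases d₁ : ModelAngleDefined κ p x₁ x₂
  swap; · exact Or.inr (Or.inl d₁)
  by_cases d₂ : ModelAngleDefined κ p x₂ x₃
  swap; · exact Or.inr (Or.inr (Or.inl d₂))
  by_cases d₃ : ModelAngleDefined κ p x₃ x₁
  swap; · exact Or.inr (Or.inr (Or.inr d₃))
  left
  obtain ⟨γ₁, g₁, s₁, e₁⟩ := hX p x₁
  obtain ⟨γ₂, g₂, s₂, e₂⟩ := hX p x₂
  obtain ⟨γ₃, g₃, s₃, e₃⟩ := hX p x₃
  have hop : dist p o + d ≤ 100 * ρ := by linarith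
  obtain ⟨θ₁, a₁⟩ := hLd.exists_hasAngle hdκ hd0 g₁ g₂ d₁.1 d₂.1 (by rw [s₁, s₂]) (by rwa [s₁])
  obtain ⟨θ₂, a₂⟩ := hLd.exists_hasAngle hdκ hd0 g₂ g₃ d₂.1 d₃.1 (by rw [s₂, s₃]) (by rwa [s₂])
  obtain ⟨θ₃, a₃⟩ := hLd.exists_hasAngle hdκ hd0 g₃ g₁ d₃.1 d₁.1 (by rw [s₃, s₁]) (by rwa [s₃])
  have hsum := hLd.angle_add_angle_add_angle_le hdκ hd0 g₁ g₂ g₃ d₁.1 d₂.1 d₃.1 (by rw [s₁, s₂])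
    (by rw [s₂, s₃]) (by rw [s₁]; linarith) a₁ a₂ a₃
  have k₁ := key x₁ x₂ h₁ h₂ d₁ γ₁ γ₂ θ₁ g₁ g₂ s₁ s₂ e₁ e₂ a₁
  have k₂ := key x₂ x₃ h₂ h₃ d₂ γ₂ γ₃ θ₂ g₂ g₃ s₂ s₃ e₂ e₃ a₂
  have k₃ := key x₃ x₁ h₃ h₁ d₃ γ₃ γ₁ θ₃ g₃ g₁ s₃ s₁ e₃ e₁ a₃
  linarith

end Hinge

/-! ### Stability of the comparison under limits. -/

section Continuity

variable {κ : ℝ}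

theorem continuousAt_cosRatio {a b c : ℝ} (hb : sn κ b ≠ 0) (hc : sn κ c ≠ 0) :
    ContinuousAt (fun u : ℝ × ℝ × ℝ => cosRatio κ u.1 u.2.1 u.2.2) (a, b, c) := by
  have h1 := continuous_md κ
  have h2 := continuous_cs κ
  have h3 := continuous_sn κ
  unfold cosRatio
  refine ContinuousAt.div (by fun_prop) (by fun_prop) (mul_ne_zero hb hc)

variable {X Y : Type*} [MetricSpace X] [MetricSpace Y] {ι : Type*} {l : Filter ι}

theorem ModelAngleDefined.tendsto_modelAngle {p q r : Y} (h : ModelAngleDefined κ p q r)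
    {p' q' r' : ι → X} (hpq : Tendsto (fun n => dist (p' n) (q' n)) l (𝓝 (dist p q)))
    (hpr : Tendsto (fun n => dist (p' n) (r' n)) l (𝓝 (dist p r)))
    (hqr : Tendsto (fun n => dist (q' n) (r' n)) l (𝓝 (dist q r))) :
    Tendsto (fun n => modelAngle κ (p' n) (q' n) (r' n)) l (𝓝 (modelAngle κ p q r)) := by
  simp only [modelAngle_eq_arccos]
  have h1 := continuousAt_cosRatio (κ := κ) (a := dist q r) h.sn_pos_left.ne' h.sn_pos_right.ne'
  have h2 := h1.tendsto.comp (hqr.prodMk_nhds (hpq.prodMk_nhds hpr))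
  exact (Real.continuous_arccos.tendsto _).comp h2

theorem ModelAngleDefined.eventually {p q r : Y} (h : ModelAngleDefined κ p q r)
    {p' q' r' : ι → X} (hpq : Tendsto (fun n => dist (p' n) (q' n)) l (𝓝 (dist p q)))
    (hpr : Tendsto (fun n => dist (p' n) (r' n)) l (𝓝 (dist p r)))
    (hqr : Tendsto (fun n => dist (q' n) (r' n)) l (𝓝 (dist q r))) :
    ∀ᶠ n in l, ModelAngleDefined κ (p' n) (q' n) (r' n) := by
  have h3 : ∀ᶠ n in l, 0 < κ →
      dist (p' n) (q' n) + dist (q' n) (r' n) + dist (r' n) (p' n) < 2 * (π / √κ) := by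
    by_cases hk : 0 < κ
    · have := h.2.2 hk
      rw [dist_comm r p] at this
      filter_upwards [((hpq.add hqr).add hpr).eventually_lt_const this] with n hn _
      rwa [dist_comm (r' n)]
    · exact Eventually.of_forall fun _ hk' => absurd hk' hk
  filter_upwards [hpq.eventually_const_lt h.1, hpr.eventually_const_lt h.2.1, h3] with n h1 h2 h3
  exact ⟨h1, h2, h3⟩

/-- The four-point comparison passes to limits of quadruples. -/
theorem FourPointComparison.of_tendsto [l.NeBot] {p x₁ x₂ x₃ : Y} {p' y₁ y₂ y₃ : ι → X}
    (h₁ : Tendsto (fun n => dist (p' n) (y₁ n)) l (𝓝 (dist p x₁)))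
    (h₂ : Tendsto (fun n => dist (p' n) (y₂ n)) l (𝓝 (dist p x₂)))
    (h₃ : Tendsto (fun n => dist (p' n) (y₃ n)) l (𝓝 (dist p x₃)))
    (h₁₂ : Tendsto (fun n => dist (y₁ n) (y₂ n)) l (𝓝 (dist x₁ x₂)))
    (h₂₃ : Tendsto (fun n => dist (y₂ n) (y₃ n)) l (𝓝 (dist x₂ x₃)))
    (h₃₁ : Tendsto (fun n => dist (y₃ n) (y₁ n)) l (𝓝 (dist x₃ x₁)))
    (H : ∀ᶠ n in l, FourPointComparison κ (p' n) (y₁ n) (y₂ n) (y₃ n)) :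
    FourPointComparison κ p x₁ x₂ x₃ := by
  by_cases d₁ : ModelAngleDefined κ p x₁ x₂
  swap; · exact Or.inr (Or.inl d₁)
  by_cases d₂ : ModelAngleDefined κ p x₂ x₃
  swap; · exact Or.inr (Or.inr (Or.inl d₂))
  by_cases d₃ : ModelAngleDefined κ p x₃ x₁
  swap; · exact Or.inr (Or.inr (Or.inr d₃))
  left
  refine le_of_tendsto (((d₁.tendsto_modelAngle h₁ h₂ h₁₂).add
    (d₂.tendsto_modelAngle h₂ h₃ h₂₃)).add (d₃.tendsto_modelAngle h₃ h₁ h₃₁)) ?_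
  -- Definedness is an open condition, so the exceptional alternatives drop out along the filter.
  filter_upwards [H, d₁.eventually h₁ h₂ h₁₂, d₂.eventually h₂ h₃ h₂₃, d₃.eventually h₃ h₁ h₃₁]
    with n hn e₁ e₂ e₃
  rcases hn with h | h | h | h
  · exact h
  all_goals contradiction

end Continuity

/-! ### The ultrapower and its geodesics. -/

/-- Sequences at bounded distance from a base point. -/
structure BoundedSeq {X : Type*} [MetricSpace X] (o : X) where
  toFun : ℕ → X
  bdd : ∃ C, ∀ n, dist (toFun n) o ≤ C

namespace BoundedSeq

variable {X : Type*} [MetricSpace X] {o : X}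

theorem exists_tendsto (f g : BoundedSeq o) :
    ∃ d, Tendsto (fun n => dist (f.toFun n) (g.toFun n)) (hyperfilter ℕ : Filter ℕ) (𝓝 d) := by
  obtain ⟨C, hC⟩ := f.bdd
  obtain ⟨D, hD⟩ := g.bdd
  obtain ⟨d, -, hd⟩ := (isCompact_Icc (a := (0 : ℝ)) (b := C + D)).ultrafilter_le_nhds
    ((hyperfilter ℕ).map fun n => dist (f.toFun n) (g.toFun n)) (by
      rw [le_principal_iff]
      refine Filter.mem_map.2 (Filter.univ_mem' fun n => mem_preimage.2 ⟨dist_nonneg, ?_⟩)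
      exact (dist_triangle_right _ _ o).trans (add_le_add (hC n) (hD n)))
  exact ⟨d, hd⟩

noncomputable instance : PseudoMetricSpace (BoundedSeq o) where
  dist f g := (exists_tendsto f g).choose
  dist_self f := tendsto_nhds_unique (exists_tendsto f f).choose_spec (by simp)
  dist_comm f g := tendsto_nhds_unique (exists_tendsto f g).choose_spec (by
    simpa only [dist_comm] using (exists_tendsto g f).choose_spec)
  dist_triangle f g h := le_of_tendsto_of_tendsto (exists_tendsto f h).choose_spec
    ((exists_tendsto f g).choose_spec.add (exists_tendsto g h).choose_spec)
    (Eventually.of_forall fun _ => dist_triangle _ _ _)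

theorem tendsto_dist (f g : BoundedSeq o) :
    Tendsto (fun n => dist (f.toFun n) (g.toFun n)) (hyperfilter ℕ : Filter ℕ) (𝓝 (dist f g)) :=
  (exists_tendsto f g).choose_spec

end BoundedSeq

/-- The metric ultrapower of `X` based at `o`. -/
abbrev Ultrapower {X : Type*} [MetricSpace X] (o : X) := SeparationQuotient (BoundedSeq o)

namespace Ultrapower

variable {X : Type*} [MetricSpace X] {o : X} {κ : ℝ}

/-- The diagonal embedding into the ultrapower. -/
noncomputable def diag (o x : X) : Ultrapower o := SeparationQuotient.mk ⟨fun _ => x, dist x o, fun _ => le_rfl⟩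

theorem tendsto_dist (f g : BoundedSeq o) :
    Tendsto (fun n => dist (f.toFun n) (g.toFun n)) (hyperfilter ℕ : Filter ℕ)
      (𝓝 (dist (SeparationQuotient.mk f : Ultrapower o) (SeparationQuotient.mk g))) := by
  rw [SeparationQuotient.dist_mk]; exact BoundedSeq.tendsto_dist f g

theorem dist_diag (x y : X) : dist (diag o x) (diag o y) = dist x y :=
  tendsto_nhds_unique (tendsto_dist _ _) tendsto_const_nhds

theorem fourPointComparison_of_diag {p x₁ x₂ x₃ : X}
    (h : FourPointComparison κ (diag o p) (diag o x₁) (diag o x₂) (diag o x₃)) :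
    FourPointComparison κ p x₁ x₂ x₃ := by
  simpa only [FourPointComparison, modelAngle, ModelAngleDefined, dist_diag] using h

/-- The strict distance bounds hold for almost all indices, so the comparison is available there and
passes to the limit. -/
theorem localComparison {R r : ℝ} (h : LocalComparison κ o R r) :
    LocalComparison κ (diag o o) R r := by
  intro p x₁ x₂ x₃ hp h₁ h₂ h₃
  obtain ⟨p, rfl⟩ := SeparationQuotient.surjective_mk p
  obtain ⟨x₁, rfl⟩ := SeparationQuotient.surjective_mk x₁
  obtain ⟨x₂, rfl⟩ := SeparationQuotient.surjective_mk x₂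
  obtain ⟨x₃, rfl⟩ := SeparationQuotient.surjective_mk x₃
  refine FourPointComparison.of_tendsto (tendsto_dist _ _) (tendsto_dist _ _) (tendsto_dist _ _)
    (tendsto_dist _ _) (tendsto_dist _ _) (tendsto_dist _ _) ?_
  filter_upwards [(tendsto_dist _ _).eventually_lt_const hp,
    (tendsto_dist _ _).eventually_lt_const h₁, (tendsto_dist _ _).eventually_lt_const h₂,
    (tendsto_dist _ _).eventually_lt_const h₃] with n e e₁ e₂ e₃
  exact h _ _ _ _ e e₁ e₂ e₃

end Ultrapower

/-- In a length space two points are joined by almost minimizing curves. -/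
theorem IsLengthSpace.exists_approx_geod {X : Type*} [MetricSpace X] (hX : IsLengthSpace X)
    (x y : X) {ε : ℝ} (hε : 0 < ε) :
    ∃ c : ℝ → X, (∀ s ∈ Icc 0 (dist x y), dist x (c s) = s) ∧ dist (c (dist x y)) y ≤ ε ∧
      ∀ s ∈ Icc 0 (dist x y), ∀ t ∈ Icc 0 (dist x y), dist (c s) (c t) ≤ |s - t| + ε := by
  have h1 : ⨅ γ : Path x y, eVariationOn γ Set.univ < edist x y + ENNReal.ofReal ε := by
    rw [hX x y]
    exact ENNReal.lt_add_right (edist_ne_top _ _) (by simpa using hε)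
  obtain ⟨γ, hγ⟩ := iInf_lt_iff.1 h1
  have key : ∀ u v : unitInterval, u ≤ v →
      dist x (γ u) + dist (γ u) (γ v) + dist (γ v) y ≤ dist x y + ε := by
    intro u v huv
    let w : ℕ → unitInterval := fun i =>
      match i with
      | 0 => 0
      | 1 => u
      | 2 => v
      | _ => 1
    have hw : Monotone w := by
      refine monotone_nat_of_le_succ fun i => ?_
      match i with
      | 0 => exact u.2.1
      | 1 => exact huv
      | 2 => exact v.2.2
      | _ + 3 => exact le_rfl
    have h2 := (eVariationOn.sum_le (f := γ) (n := 3) hw fun i => mem_univ _).trans hγ.le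
    simp only [Finset.sum_range_succ, Finset.sum_range_zero, zero_add, w, γ.source, γ.target,
      edist_dist] at h2
    rw [← ENNReal.ofReal_add (by positivity) (by positivity),
      ← ENNReal.ofReal_add (by positivity) (by positivity),
      ← ENNReal.ofReal_add (by positivity) (by positivity),
      ENNReal.ofReal_le_ofReal_iff (by positivity)] at h2
    rw [dist_comm x (γ u), dist_comm (γ u) (γ v), dist_comm _ y]
    exact h2
  have hcont : Continuous fun u : unitInterval => dist x (γ u) := by fun_prop
  -- The almost minimizing path is reparametrized by the distance to `x`.
  have ivt : ∀ s ∈ Icc 0 (dist x y), ∃ u : unitInterval, dist x (γ u) = s := by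
    intro s hs
    have := intermediate_value_univ (0 : unitInterval) 1 hcont
    exact this (by simpa using hs)
  choose! u hu using ivt
  have aux : ∀ s ∈ Icc 0 (dist x y), ∀ t ∈ Icc 0 (dist x y), u s ≤ u t →
      dist (γ (u s)) (γ (u t)) ≤ |s - t| + ε := by
    intro s hs t ht hst
    have h := key _ _ hst
    rw [hu s hs] at h
    have h2 := dist_triangle x (γ (u t)) y
    rw [hu t ht] at h2
    linarith [neg_abs_le (s - t)]
  refine ⟨fun s => γ (u s), hu, ?_, fun s hs t ht => ?_⟩
  · have h := key _ _ (le_refl (u (dist x y)))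
    rw [hu _ ⟨dist_nonneg, le_rfl⟩, dist_self] at h
    linarith
  · rcases le_total (u s) (u t) with h | h
    · exact aux s hs t ht h
    · rw [dist_comm, abs_sub_comm]; exact aux t ht s hs h

/-- The ultrapower of a length space is geodesic. -/
theorem Ultrapower.isGeodesicSpace {X : Type*} [MetricSpace X] (hX : IsLengthSpace X) (o : X) :
    IsGeodesicSpace (Ultrapower o) := by
  intro x y
  obtain ⟨x, rfl⟩ := SeparationQuotient.surjective_mk x
  obtain ⟨y, rfl⟩ := SeparationQuotient.surjective_mk y
  choose c hc₁ hc₂ hc₃ using fun n : ℕ => hX.exists_approx_geod (x.toFun n) (y.toFun n)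
    (Nat.one_div_pos_of_nat (α := ℝ) (n := n))
  set D := dist (SeparationQuotient.mk x : Ultrapower o) (SeparationQuotient.mk y) with hD
  have hε : Tendsto (fun n : ℕ => 1 / ((n : ℝ) + 1)) (hyperfilter ℕ : Filter ℕ) (𝓝 0) :=
    tendsto_one_div_add_atTop_nhds_zero_nat.mono_left Nat.hyperfilter_le_atTop
  have hDn := tendsto_dist x y
  -- The distances between the `n`-th terms only converge to `D`, so the parameter is truncated to
  -- the range where `c n` is controlled.
  let clip : ℕ → ℝ → ℝ := fun n t => max 0 (min t (dist (x.toFun n) (y.toFun n)))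
  have hclip : ∀ n t, clip n t ∈ Icc 0 (dist (x.toFun n) (y.toFun n)) := fun n t =>
    ⟨le_max_left _ _, max_le dist_nonneg (min_le_right _ _)⟩
  have hclip' : ∀ n s t, |clip n s - clip n t| ≤ |s - t| := fun n s t =>
    (abs_max_sub_max_le_max _ _ _ _).trans (max_le (by simp)
      ((abs_min_sub_min_le_max _ _ _ _).trans (max_le le_rfl (by simp))))
  obtain ⟨C, hC⟩ := x.bdd
  obtain ⟨C', hC'⟩ := y.bdd
  let f : ℝ → BoundedSeq o := fun t => ⟨fun n => c n (clip n t), C + C' + C, fun n => by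
    have h1 := dist_triangle_left (c n (clip n t)) o (x.toFun n)
    rw [hc₁ n _ (hclip n t)] at h1
    linarith [hC n, hC' n, dist_triangle_right (x.toFun n) (y.toFun n) o, (hclip n t).2]⟩
  let γ : ℝ → Ultrapower o := fun t => SeparationQuotient.mk (f t)
  have hlip : ∀ s t, dist (γ s) (γ t) ≤ |s - t| := by
    intro s t
    have h1 : Tendsto (fun n : ℕ => |s - t| + 1 / ((n : ℝ) + 1)) (hyperfilter ℕ : Filter ℕ)
        (𝓝 (|s - t| + 0)) := tendsto_const_nhds.add hε
    rw [add_zero] at h1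
    refine le_of_tendsto_of_tendsto (tendsto_dist (f s) (f t)) h1 (Eventually.of_forall fun n => ?_)
    exact (hc₃ n _ (hclip n s) _ (hclip n t)).trans (add_le_add_left (hclip' n s t) _)
  have hγ0 : γ 0 = SeparationQuotient.mk x := by
    refine dist_eq_zero.1 (tendsto_nhds_unique (tendsto_dist (f 0) x) ?_)
    refine tendsto_const_nhds.congr fun n => ?_
    have h1 : clip n 0 = 0 := by simp [clip]
    have h2 := hc₁ n _ (hclip n 0)
    rw [h1, dist_comm] at h2
    simp only [f, h1, h2]
  have hγD : γ D = SeparationQuotient.mk y := by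
    refine dist_eq_zero.1 (le_antisymm ?_ dist_nonneg)
    have h1 : Tendsto (fun n : ℕ => |D - dist (x.toFun n) (y.toFun n)| + 1 / ((n : ℝ) + 1) +
        1 / ((n : ℝ) + 1)) (hyperfilter ℕ : Filter ℕ) (𝓝 (|D - D| + 0 + 0)) :=
      (((tendsto_const_nhds.sub hDn).abs).add hε).add hε
    rw [sub_self, abs_zero, add_zero, add_zero] at h1
    refine le_of_tendsto_of_tendsto (tendsto_dist (f D) y) h1 (Eventually.of_forall fun n => ?_)
    refine (dist_triangle _ (c n (dist (x.toFun n) (y.toFun n))) _).trans (add_le_add ?_ (hc₂ n))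
    refine (hc₃ n _ (hclip n D) _ ⟨dist_nonneg, le_rfl⟩).trans (add_le_add_left ?_ _)
    simpa [clip] using hclip' n D (dist (x.toFun n) (y.toFun n))
  -- A 1-Lipschitz curve on `[0, D]` whose endpoints are at distance `D` is a geodesic.
  have hle : ∀ s ∈ Icc 0 D, ∀ t ∈ Icc 0 D, s ≤ t → dist (γ s) (γ t) = |s - t| := by
    intro s hs t ht hst
    refine le_antisymm (hlip s t) ?_
    have h1 := dist_triangle4 (γ 0) (γ s) (γ t) (γ D)
    have h2 := hlip 0 s
    have h3 := hlip t D
    rw [abs_sub_comm, abs_of_nonneg (by linarith [hs.1])] at h2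
    rw [abs_sub_comm, abs_of_nonneg (by linarith [ht.2])] at h3
    rw [hγ0, hγD, ← hD] at h1
    rw [hγ0] at h2
    rw [hγD] at h3
    rw [abs_sub_comm, abs_of_nonneg (by linarith)]
    linarith
  refine ⟨γ, fun s hs t ht => ?_, hγ0, hγD⟩
  rcases le_total s t with h | h
  · exact hle s hs t ht h
  · rw [dist_comm, abs_sub_comm]; exact hle t ht s hs h

/-! ### Back to length spaces; the descent to a point. -/

/-- In a length space, four-point comparison on small scale in a large ball implies four-point
comparison on a smaller ball. -/
theorem IsLengthSpace.fourPointComparison {X : Type*} [MetricSpace X] (hX : IsLengthSpace X)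
    {κ ρ r : ℝ} {o : X} (hr : 0 < r) (h : LocalComparison κ o (100 * ρ) r) {p x₁ x₂ x₃ : X}
    (hp : dist p o < ρ) (h₁ : dist x₁ o < ρ) (h₂ : dist x₂ o < ρ) (h₃ : dist x₃ o < ρ) :
    FourPointComparison κ p x₁ x₂ x₃ :=
  Ultrapower.fourPointComparison_of_diag (o := o) <|
    (Ultrapower.localComparison h).fourPointComparison (Ultrapower.isGeodesicSpace hX o) hr
      (by rwa [Ultrapower.dist_diag]) (by rwa [Ultrapower.dist_diag])
      (by rwa [Ultrapower.dist_diag]) (by rwa [Ultrapower.dist_diag])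

/-- If the comparison fails in a ball of a length space, then it fails in a ball of half the radius
at controlled distance. -/
theorem IsLengthSpace.exists_smaller_ball {X : Type*} [MetricSpace X] (hX : IsLengthSpace X)
    {κ ρ : ℝ} {o : X} (hρ : 0 < ρ) (h : ∃ p ∈ Metric.ball o ρ, ∃ x₁ ∈ Metric.ball o ρ,
      ∃ x₂ ∈ Metric.ball o ρ, ∃ x₃ ∈ Metric.ball o ρ, ¬ FourPointComparison κ p x₁ x₂ x₃) :
    ∃ z, dist z o < 100 * ρ ∧ ∃ p ∈ Metric.ball z (ρ / 2), ∃ x₁ ∈ Metric.ball z (ρ / 2),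
      ∃ x₂ ∈ Metric.ball z (ρ / 2), ∃ x₃ ∈ Metric.ball z (ρ / 2),
        ¬ FourPointComparison κ p x₁ x₂ x₃ := by
  by_contra! H
  obtain ⟨p, hp, x₁, h₁, x₂, h₂, x₃, h₃, hn⟩ := h
  refine hn (hX.fourPointComparison (half_pos hρ) ?_ hp h₁ h₂ h₃)
  -- A failing quadruple of scale `ρ / 2` lies in the ball of that radius about its own first point
  -- `q`.
  intro q y₁ y₂ y₃ hq k₁ k₂ k₃
  refine H q hq q (Metric.mem_ball_self (half_pos hρ)) y₁ ?_ y₂ ?_ y₃ ?_ <;>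
    rwa [Metric.mem_ball, dist_comm]

/-- Bad balls of radii `ρ / 2 ^ n` have centres with geometrically summable gaps; their limit has no
good neighborhood. -/
theorem mainTheorem1 {X : Type*} [MetricSpace X] [CompleteSpace X] (hX : IsLengthSpace X)
    (κ : ℝ) (hκ : IsLocallyAlex X κ) : IsAlex X κ := by
  by_contra hA
  simp only [IsAlex, not_forall] at hA
  obtain ⟨p, x₁, x₂, x₃, hn⟩ := hA
  let Bad : X → ℝ → Prop := fun z ρ => ∃ p ∈ Metric.ball z ρ, ∃ x₁ ∈ Metric.ball z ρ,
    ∃ x₂ ∈ Metric.ball z ρ, ∃ x₃ ∈ Metric.ball z ρ, ¬ FourPointComparison κ p x₁ x₂ x₃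
  obtain ⟨ρ, hρ, hbad⟩ : ∃ ρ, 0 < ρ ∧ Bad p ρ := by
    refine ⟨dist x₁ p + dist x₂ p + dist x₃ p + 1, by positivity, p, ?_, x₁, ?_, x₂, ?_, x₃, ?_, hn⟩
    all_goals
      rw [Metric.mem_ball]
      linarith [dist_self p, dist_nonneg (x := x₁) (y := p), dist_nonneg (x := x₂) (y := p),
        dist_nonneg (x := x₃) (y := p)]
  have step : ∀ (n : ℕ) (z : {z // Bad z (ρ / 2 ^ n)}),
      ∃ z' : {z // Bad z (ρ / 2 ^ (n + 1))}, dist z'.1 z.1 < 100 * (ρ / 2 ^ n) := by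
    rintro n ⟨z, hz⟩
    obtain ⟨z', h1, h2⟩ := hX.exists_smaller_ball (by positivity) hz
    exact ⟨⟨z', by rw [pow_succ, ← div_div]; exact h2⟩, h1⟩
  choose next hnext using step
  let u : (n : ℕ) → {z // Bad z (ρ / 2 ^ n)} := fun n =>
    Nat.rec ⟨p, by simpa using hbad⟩ (fun n z => next n z) n
  have hu : ∀ n, dist (u n).1 (u (n + 1)).1 ≤ 200 * ρ / 2 / 2 ^ n := fun n => by
    rw [dist_comm]
    refine (hnext n (u n)).le.trans_eq (by ring)
  have hcau := cauchySeq_of_le_geometric_two hu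
  obtain ⟨z, hz⟩ := cauchySeq_tendsto_of_complete hcau
  obtain ⟨Ω, hΩ, hgood⟩ := hκ z
  obtain ⟨ε, hε, hball⟩ := Metric.mem_nhds_iff.1 hΩ
  have hlim : Tendsto (fun n : ℕ => dist (u n).1 z + ρ / 2 ^ n) atTop (𝓝 (0 + 0)) := by
    refine (tendsto_iff_dist_tendsto_zero.1 hz).add ?_
    exact tendsto_const_nhds.div_atTop (tendsto_pow_atTop_atTop_of_one_lt one_lt_two)
  rw [add_zero] at hlim
  obtain ⟨n, hn⟩ := (hlim.eventually_lt_const hε).exists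
  have hsub : Metric.ball (u n).1 (ρ / 2 ^ n) ⊆ Ω :=
    (Metric.ball_subset_ball' (by linarith)).trans hball
  obtain ⟨q, hq, y₁, k₁, y₂, k₂, y₃, k₃, hnot⟩ := (u n).2
  exact hnot (hgood q (hsub hq) y₁ (hsub k₁) y₂ (hsub k₂) y₃ (hsub k₃))
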